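/- Let $K\ge 2$, $d\ge 1$, $\mathcal Y=\{1,\dots,K\}^d$, where the token $K$ is the mask, and let $\mathrm{numK}(y)$ be the number of masked coordinates of $y\in\mathcal Y$. The forward generator is $R^\to(y,y')=1$ if $y$ and $y'$ differ in exactly one coordinate and $y$ is masked there, $R^\to(y,y)=-(d-\mathrm{numK}(y))$, and $R^\to(y,y')=0$ otherwise ($R^\to(y,y')$ is the rate from $y'$ to $y$). Let $q_*$ be a probability distribution on $\mathcal Y$ with $q_*(y)>0$ if and only if $\mathrm{numK}(y)=0$ (no mask in the target). Put $q^\to_t=e^{tR^\to}q_*$, $q^\gets_t=q^\to_{T-t}$ and $v_{t,y}(y')=q^\gets_t(y')/q^\gets_t(y)$. Let $\tilde v_{t,y}(y')$ be an estimator of $v_{t,y}(y')$ and $D_\phi(u\|w)=u\ln(u/w)-u+w$. For $0<\varepsilon\le 1/2$ put $T=\ln(4d/\varepsilon^2)$, $\delta=\varepsilon/d$ (early stopping), $h=(T-\delta)/n$ with $n\ge 1$ an integer. The Euler sampler starts from a law $\hat q_0$ and, for $k=0,\dots,n-1$, moves from $y$ to $y'\ne y$ with probability $h\,R^\to(y,y')\,\tilde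 v_{kh,y}(y')$ and otherwise stays at $y$ (so at most one masked coordinate is revealed per step); $\hat p$ is its law after $n$ steps. For every $M>0$ there are constants $c,C>0$ depending only on $M$ such that for all $K\ge2$, $d\ge1$, $0<\varepsilon\le1/2$ the following holds. Consider the step-size condition $$h\le c\,\min\Big\{\frac{\varepsilon}{K^2d^2\ln(d/\varepsilon)},\ \frac{\varepsilon^{3/2}}{d\sqrt{\ln(d/\varepsilon)}}\Big\}.\qquad(\ast)$$ (i) There is a number of iterations $n\le C\,K^2\ln^2(d/\varepsilon)\,d^2\varepsilon^{-3/2}$ for which $(\ast)$ holds; thus, for fixed $K$, $\tilde O(d^2\varepsilon^{-3/2})$ iterations suffice. (ii) Let $n$ satisfy $(\ast)$, let $q_*$ be as above, and assume the bounded-score condition $0<\tilde v_{kh,y}(y')\le M\,d/\varepsilon$ for all $k<n$ and all $y\neq y'$ with $R^\to(y,y')\ne0$ (in particular, this upper bound holds if $\tilde v\le M$), and the discretized score-error bound $$\frac1{T-\delta}\sum_{k=0}^{n-1}\int_{kh}^{(k+1)h}\mathbb E_{y_t\sim q^\gets_t}\Big[\sum_{y\ne y_t}R^\to(y_t,y)\,D_\phi\big(v_{kh,y_t}(y)\,\|\,\tilde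 v_{kh,y_t}(y)\big)\Big]dt\le\varepsilon_{\rm score}^2,\qquad 0\le\varepsilon_{\rm score}\le c\,\frac{\varepsilon^2}{d}.$$ Then all Euler transition probabilities are non-negative, and $\mathrm{TV}(q_*,\hat p)\le2\varepsilon$ if $\hat q_0$ is the point mass at the fully masked sequence; the same holds for $\hat q_0(y)\propto\exp(-T(d-\mathrm{numK}(y)))$ provided $K\varepsilon\le1$. -/

import Mathlib

open scoped BigOperators Matrix

noncomputable section

namespace MaskedDiffusion

/-- Sequences of `d` tokens from the vocabulary `{1, …, K}`. The token `j + 1` of the vocabulary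
is represented by `j : Fin K`. -/
abbrev Sq (K d : ℕ) : Type := Fin d → Fin K

/-- The mask is the last token of the vocabulary. -/
def IsMask {K : ℕ} (a : Fin K) : Prop := (a : ℕ) + 1 = K

instance {K : ℕ} : DecidablePred (IsMask (K := K)) := fun a =>
  inferInstanceAs (Decidable ((a : ℕ) + 1 = K))

/-- The number of masked coordinates of a sequence. -/
def numMask {K d : ℕ} (y : Sq K d) : ℕ := (Finset.univ.filter fun i => IsMask (y i)).card

/-- A function on a finite type is a probability mass function. -/
def IsProb {α : Type*} [Fintype α] (p : α → ℝ) : Prop := (∀ a, 0 ≤ p a) ∧ ∑ a, p a = 1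

/-- Total variation distance of two mass functions on a finite type. -/
def tvDist {α : Type*} [Fintype α] (p q : α → ℝ) : ℝ := (1 / 2) * ∑ a, |p a - q a|

/-- The absorbing forward generator; the entry `(y, y')` is the rate from `y'` to `y`:
each unmasked coordinate becomes masked at rate `1`. -/
def fwdRate (K d : ℕ) : Matrix (Sq K d) (Sq K d) ℝ :=
  Matrix.of fun y y' =>
    if y = y' then -((d : ℝ) - numMask y)
    else if hammingDist y y' = 1 ∧ ∀ i, y i ≠ y' i → IsMask (y i) then 1
    else 0

/-- Marginal law at time `t` of the forward continuous-time Markov chain started from `q`. -/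
def fwdLaw {K d : ℕ} (q : Sq K d → ℝ) (t : ℝ) : Sq K d → ℝ :=
  NormedSpace.exp (t • fwdRate K d) *ᵥ q

/-- Marginal law at time `t` of the reverse process over the horizon `T`. -/
def revLaw {K d : ℕ} (q : Sq K d → ℝ) (T t : ℝ) : Sq K d → ℝ := fwdLaw q (T - t)

/-- The discrete score at the state `y`: the density ratio of the reverse law at time `t`. -/
def score {K d : ℕ} (q : Sq K d → ℝ) (T t : ℝ) (y y' : Sq K d) : ℝ :=
  revLaw q T t y' / revLaw q T t y

/-- The Bregman divergence of `φ(c) = c ln c`, for positive arguments. -/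
def bregman (u v : ℝ) : ℝ := u * Real.log (u / v) - u + v

/-- The discretized score-entropy loss of the estimator `s` (`s t y y'` estimates `score q T t y y'`)
for `n` steps of length `h` with horizon `T` and early stopping `δ`, where `T = n h + δ`. -/
def disScoreLoss {K d : ℕ} (q : Sq K d → ℝ) (s : ℝ → Sq K d → Sq K d → ℝ)
    (T δ h : ℝ) (n : ℕ) : ℝ :=
  (1 / (T - δ)) * ∑ k ∈ Finset.range n, ∫ t in ((k : ℝ) * h)..(((k : ℝ) + 1) * h),
    ∑ y, revLaw q T t y * ∑ y' ∈ Finset.univ.erase y,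
      fwdRate K d y y' * bregman (score q T ((k : ℝ) * h) y y') (s ((k : ℝ) * h) y y')

/-- The estimated reverse generator at time `t`; the entry `(y', y)` is the rate from `y` to `y'`.
The diagonal makes the total rate out of every state balance. -/
def estRate {K d : ℕ} (s : ℝ → Sq K d → Sq K d → ℝ) (t : ℝ) : Matrix (Sq K d) (Sq K d) ℝ :=
  Matrix.of fun y' y =>
    if y' = y then -∑ z ∈ Finset.univ.erase y, fwdRate K d y z * s t y z
    else fwdRate K d y y' * s t y y'

/-- One Euler step of length `h` at time `t`; the entry `(y', y)` is the probability of moving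
from `y` to `y'`. Each column sums to `1`, and at most one masked token is revealed. -/
def eulerKernel {K d : ℕ} (s : ℝ → Sq K d → Sq K d → ℝ) (h t : ℝ) :
    Matrix (Sq K d) (Sq K d) ℝ :=
  1 + h • estRate s t

/-- Law of the Euler chain after `k` steps of length `h`, from the initial law `p`. -/
def eulerLaw {K d : ℕ} (s : ℝ → Sq K d → Sq K d → ℝ) (h : ℝ) (p : Sq K d → ℝ) :
    ℕ → Sq K d → ℝ
  | 0 => p
  | k + 1 => eulerKernel s h ((k : ℝ) * h) *ᵥ eulerLaw s h p k

/-- The point mass at the fully masked sequence. -/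
def maskLaw (K d : ℕ) : Sq K d → ℝ := fun y => if numMask y = d then 1 else 0

/-- The product law on sequences with mass proportional to `exp (-T * (d - numMask y))`. -/
def tiltedLaw (K d : ℕ) (T : ℝ) : Sq K d → ℝ := fun y =>
  Real.exp (-T * ((d : ℝ) - numMask y)) / ∑ z : Sq K d, Real.exp (-T * ((d : ℝ) - numMask z))

/-- The time horizon. -/
def horizon (d : ℕ) (ε : ℝ) : ℝ := Real.log (4 * d / ε ^ 2)

/-- The early-stopping time. -/
def earlyStop (d : ℕ) (ε : ℝ) : ℝ := ε / d

/-- The length of each of `n` equal steps that cover `[0, T - δ]`. -/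
def stepSize (d : ℕ) (ε : ℝ) (n : ℕ) : ℝ := (horizon d ε - earlyStop d ε) / n

/-- The scale of the admissible step sizes. -/
def stepBound (K d : ℕ) (ε : ℝ) : ℝ :=
  min (ε / ((K : ℝ) ^ 2 * (d : ℝ) ^ 2 * Real.log (d / ε)))
    (ε ^ (3 / 2 : ℝ) / (d * Real.sqrt (Real.log (d / ε))))

end MaskedDiffusion

end

/-!
# Convergence of the Euler sampler for masked diffusion

The argument compares laws in total variation, one Euler step at a time, without path measures.

Let `q_t` be the forward law and `R` the forward generator. `R` is a sum over the coordinates of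
"jump to the mask at rate one" (`fwdRate_apply`), so its norm on `ℓ¹` is at most `2 d`, and its
semigroup is a product of explicit one-token kernels (`exp_smul_fwdRate`).

* *Discretization.* The reverse generator built from the exact score acts on the reverse law as `-R`
  (`estRate_score_mulVec`). So an exact-score Euler step maps `q_t` to `q_t - h R q_t`, which is the
  first-order expansion of `q_{t-h}`, with `ℓ¹` error at most `4 d² h²`
  (`tvDist_fwdLaw_sub_linear_le`). Over `T / h` steps this costs `O(T d² h)`.
* *Score.* Replacing the score `v` by its estimate `s` costs `h 𝔼 ∑ R |v - s|` per step
  (`tvDist_eulerKernel_le`). By a linearized Pinsker inequality, `|v - s| ≤ 2 μ v + D(v ‖ s) / μ`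
  for every `μ ≤ 1 / 2` (`abs_sub_le_bregman`), where `𝔼 ∑ R v ≤ d`. The loss averages over `q_t`
  within a step rather than at its start, but the product form of the kernel shows that these laws
  are comparable up to a factor `2` once `d h ≤ δ / 2` (`half_mul_fwdLaw_le`). The choice
  `μ = ε / (64 T d)` makes the total `O(ε)`.
* *Endpoints.* Early stopping costs `d δ = ε` (`tvDist_fwdLaw_self_le`). At time `T` the law is
  within `d exp (-T) = ε² / 4` of the fully masked point mass, which is within `K ε² / 4` of the
  tilted law.

Under the step-size condition the Euler kernels are stochastic, hence do not increase total
variation, and the errors add up (`tvDist_eulerLaw_le`).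
-/

namespace MaskedDiffusion

variable {K d : ℕ}

/-! ### The forward generator -/

theorem isMask_iff_eq {m : Fin K} (hm : IsMask m) (a : Fin K) : IsMask a ↔ a = m := by
  unfold IsMask at *
  rw [Fin.ext_iff]
  omega

/-- The forward generator is the sum over the coordinates of the generators
"replace the coordinate by the mask at rate `1`". -/
theorem fwdRate_apply {m : Fin K} (hm : IsMask m) (y z : Sq K d) :
    fwdRate K d y z = ∑ i, ((if y = Function.update z i m then (1 : ℝ) else 0) -
      if y = z then 1 else 0) := by
  by_cases hyz : y = z
  · subst hyz
    have h : ∀ i, (y = Function.update y i m) ↔ IsMask (y i) := fun i => by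
      rw [isMask_iff_eq hm]
      constructor
      · intro h
        rw [h]
        simp
      · intro h
        rw [← h, Function.update_eq_self]
    simp [fwdRate, h, numMask]
  · simp only [fwdRate, Matrix.of_apply, hyz, if_false, sub_zero]
    split_ifs with h
    · obtain ⟨h1, h2⟩ := h
      rw [hammingDist, Finset.card_eq_one] at h1
      obtain ⟨i, hi⟩ := h1
      have hi' : ∀ j, y j ≠ z j ↔ j = i := fun j => by
        have := Finset.ext_iff.1 hi j
        simpa using this
      rw [Finset.sum_eq_single i]
      · rw [if_pos]
        funext j
        by_cases hj : j = i
        · subst hj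
          simpa [← isMask_iff_eq hm] using h2 j ((hi' j).2 rfl)
        · rw [Function.update_of_ne hj]
          by_contra hne
          exact hj ((hi' j).1 hne)
      · intro j _ hj
        rw [if_neg]
        intro he
        have := (hi' i).2 rfl
        rw [he, Function.update_of_ne (Ne.symm hj)] at this
        exact this rfl
      · simp
    · symm
      refine Finset.sum_eq_zero fun i _ => if_neg fun he => h ?_
      have hj : ∀ j, y j ≠ z j → j = i := fun j hne => by
        by_contra hj
        rw [he, Function.update_of_ne hj] at hne
        exact hne rfl
      have hi : y i ≠ z i := by
        obtain ⟨j, hne⟩ := Function.ne_iff.1 hyz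
        exact hj j hne ▸ hne
      constructor
      · rw [hammingDist, Finset.card_eq_one]
        refine ⟨i, Finset.ext fun j => ?_⟩
        simp only [Finset.mem_filter, Finset.mem_univ, true_and, Finset.mem_singleton]
        exact ⟨hj j, fun h => h ▸ hi⟩
      · intro j hne
        rw [isMask_iff_eq hm, hj j hne, he]
        simp

theorem fwdRate_nonneg_of_ne {y z : Sq K d} (h : y ≠ z) : 0 ≤ fwdRate K d y z := by
  simp only [fwdRate, Matrix.of_apply, if_neg h]
  split_ifs <;> norm_num

theorem fwdRate_le_sum {m : Fin K} (hm : IsMask m) (y z : Sq K d) :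
    fwdRate K d y z ≤ ∑ i, if y = Function.update z i m then (1 : ℝ) else 0 := by
  rw [fwdRate_apply hm]
  refine Finset.sum_le_sum fun i _ => ?_
  split_ifs <;> norm_num

theorem sum_fwdRate_col {m : Fin K} (hm : IsMask m) (z : Sq K d) :
    ∑ y, fwdRate K d y z = 0 := by
  simp_rw [fwdRate_apply hm]
  rw [Finset.sum_comm]
  simp

/-- The total rate out of a state is at most `d`. -/
theorem sum_erase_fwdRate_col_le {m : Fin K} (hm : IsMask m) (z : Sq K d) :
    ∑ y ∈ Finset.univ.erase z, fwdRate K d y z ≤ d := by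
  calc ∑ y ∈ Finset.univ.erase z, fwdRate K d y z
      ≤ ∑ y ∈ Finset.univ.erase z, ∑ i, if y = Function.update z i m then (1 : ℝ) else 0 :=
        Finset.sum_le_sum fun y _ => fwdRate_le_sum hm y z
    _ ≤ ∑ y, ∑ i, if y = Function.update z i m then (1 : ℝ) else 0 :=
        Finset.sum_le_sum_of_subset_of_nonneg (Finset.erase_subset _ _) fun _ _ _ =>
          Finset.sum_nonneg fun i _ => by split_ifs <;> norm_num
    _ = d := by
        rw [Finset.sum_comm]
        simp

/-- The total rate into a state is at most `K d`. -/
theorem sum_erase_fwdRate_row_le {m : Fin K} (hm : IsMask m) (y : Sq K d) :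
    ∑ z ∈ Finset.univ.erase y, fwdRate K d y z ≤ d * K := by
  calc ∑ z ∈ Finset.univ.erase y, fwdRate K d y z
      ≤ ∑ z ∈ Finset.univ.erase y, ∑ i, if y = Function.update z i m then (1 : ℝ) else 0 :=
        Finset.sum_le_sum fun z _ => fwdRate_le_sum hm y z
    _ ≤ ∑ z, ∑ i, if y = Function.update z i m then (1 : ℝ) else 0 :=
        Finset.sum_le_sum_of_subset_of_nonneg (Finset.erase_subset _ _) fun _ _ _ =>
          Finset.sum_nonneg fun i _ => by split_ifs <;> norm_num
    _ = ∑ i : Fin d, ((Finset.univ.filter fun z => y = Function.update z i m).card : ℝ) := by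
        rw [Finset.sum_comm]
        simp
    _ ≤ ∑ _i : Fin d, (K : ℝ) := by
        refine Finset.sum_le_sum fun i _ => ?_
        -- a preimage of `y` under the masking of coordinate `i` is determined by that coordinate
        have h : (Finset.univ.filter fun z => y = Function.update z i m).card ≤
            (Finset.univ : Finset (Fin K)).card := by
          refine Finset.card_le_card_of_injOn (fun z => z i) (fun _ _ => Finset.mem_univ _) ?_
          intro z hz w hw hzw
          simp only [Finset.coe_filter, Finset.mem_univ, true_and, Set.mem_ofPred_eq] at hz hw
          funext j
          by_cases hj : j = i
          · exact hj ▸ hzw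
          · have := congrFun (hz.symm.trans hw) j
            simpa [Function.update_of_ne hj] using this
        simpa using h
    _ = d * K := by simp

/-- The operator norm of the forward generator on `ℓ¹` is at most `2 d`. -/
theorem sum_abs_fwdRate_mulVec_le {m : Fin K} (hm : IsMask m) (f : Sq K d → ℝ) :
    ∑ y, |(fwdRate K d *ᵥ f) y| ≤ 2 * d * ∑ y, |f y| := by
  have hcol : ∀ z : Sq K d, ∑ y, |fwdRate K d y z| ≤ 2 * d := fun z => by
    calc ∑ y, |fwdRate K d y z|
        ≤ ∑ y, ∑ i : Fin d, ((if y = Function.update z i m then (1 : ℝ) else 0) +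
          if y = z then 1 else 0) := by
          refine Finset.sum_le_sum fun y _ => ?_
          rw [fwdRate_apply hm]
          refine (Finset.abs_sum_le_sum_abs _ _).trans (Finset.sum_le_sum fun i _ => ?_)
          split_ifs <;> norm_num
      _ = 2 * d := by
          rw [Finset.sum_comm]
          simp [Finset.sum_add_distrib]
          ring
  calc ∑ y, |(fwdRate K d *ᵥ f) y|
      ≤ ∑ y, ∑ z, |fwdRate K d y z| * |f z| := by
        refine Finset.sum_le_sum fun y _ => ?_
        rw [Matrix.mulVec, dotProduct]
        refine (Finset.abs_sum_le_sum_abs _ _).trans (le_of_eq ?_)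
        simp_rw [abs_mul]
    _ = ∑ z, (∑ y, |fwdRate K d y z|) * |f z| := by
        rw [Finset.sum_comm]
        simp_rw [Finset.sum_mul]
    _ ≤ ∑ z, 2 * d * |f z| :=
        Finset.sum_le_sum fun z _ => mul_le_mul_of_nonneg_right (hcol z) (abs_nonneg _)
    _ = 2 * d * ∑ y, |f y| := by rw [Finset.mul_sum]

/-! ### The forward transition kernel -/

/-- Transition kernel of a single token after time `t`: the entry `(a, b)` is the probability that
the token `b` has become `a`. The token `b` survives with probability `exp (-t)`. -/
noncomputable def siteKernel (t : ℝ) (a b : Fin K) : ℝ :=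
  Real.exp (-t) * (if a = b then 1 else 0) + (1 - Real.exp (-t)) * if IsMask a then 1 else 0

/-- Transition kernel of a sequence whose tokens are masked independently, after time `t`. -/
noncomputable def seqKernel (K d : ℕ) (t : ℝ) : Matrix (Sq K d) (Sq K d) ℝ :=
  Matrix.of fun y x => ∏ i, siteKernel t (y i) (x i)

theorem siteKernel_mask {m : Fin K} (hm : IsMask m) (t : ℝ) (a : Fin K) :
    siteKernel t a m = if IsMask a then 1 else 0 := by
  simp only [siteKernel, isMask_iff_eq hm]
  split_ifs <;> ring

theorem siteKernel_nonneg {t : ℝ} (ht : 0 ≤ t) (a b : Fin K) : 0 ≤ siteKernel t a b := by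
  have h1 : Real.exp (-t) ≤ 1 := Real.exp_le_one_iff.2 (by linarith)
  have h2 := Real.exp_pos (-t)
  unfold siteKernel
  split_ifs <;> nlinarith

theorem sum_siteKernel {m : Fin K} (hm : IsMask m) (t : ℝ) (b : Fin K) :
    ∑ a, siteKernel t a b = 1 := by
  simp only [siteKernel, isMask_iff_eq hm, Finset.sum_add_distrib, ← Finset.mul_sum]
  simp

theorem seqKernel_nonneg {t : ℝ} (ht : 0 ≤ t) (y x : Sq K d) : 0 ≤ seqKernel K d t y x := by
  simp only [seqKernel, Matrix.of_apply]
  exact Finset.prod_nonneg fun i _ => siteKernel_nonneg ht (y i) (x i)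

theorem sum_seqKernel {m : Fin K} (hm : IsMask m) (t : ℝ) (x : Sq K d) :
    ∑ y, seqKernel K d t y x = 1 := by
  simp only [seqKernel, Matrix.of_apply]
  rw [← Fintype.prod_sum (fun i a => siteKernel t a (x i))]
  simp [sum_siteKernel hm]

theorem hasDerivAt_siteKernel (t : ℝ) (a b : Fin K) :
    HasDerivAt (fun t => siteKernel t a b) ((if IsMask a then 1 else 0) - siteKernel t a b) t := by
  have h : HasDerivAt (fun t : ℝ => Real.exp (-t)) (-Real.exp (-t)) t := by
    simpa using (hasDerivAt_neg t).exp
  have := (h.mul_const (if a = b then (1 : ℝ) else 0)).add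
    ((h.const_sub 1).mul_const (if IsMask a then (1 : ℝ) else 0))
  refine this.congr_deriv ?_
  unfold siteKernel
  ring

theorem seqKernel_zero : seqKernel K d 0 = 1 := by
  ext y x
  simp only [seqKernel, siteKernel, Matrix.of_apply, neg_zero, Real.exp_zero, sub_self, zero_mul,
    add_zero, one_mul, Matrix.one_apply]
  rw [Finset.prod_ite_zero]
  simp [funext_iff]

/-- Kolmogorov's equation for the product kernel. -/
theorem hasDerivAt_seqKernel_apply {m : Fin K} (hm : IsMask m) (t : ℝ) (y x : Sq K d) :
    HasDerivAt (fun t => seqKernel K d t y x) ((seqKernel K d t * fwdRate K d) y x) t := by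
  have h := HasDerivAt.fun_finsetProd (u := Finset.univ) (x := t)
    (fun i _ => hasDerivAt_siteKernel t (y i) (x i))
  refine h.congr_deriv ?_
  have hx : (seqKernel K d t * fwdRate K d) y x =
      ∑ i, (seqKernel K d t y (Function.update x i m) - seqKernel K d t y x) := by
    simp only [Matrix.mul_apply, fwdRate_apply hm, Finset.mul_sum]
    rw [Finset.sum_comm]
    simp [mul_sub]
  rw [hx]
  refine Finset.sum_congr rfl fun i _ => ?_
  simp only [seqKernel, Matrix.of_apply, smul_eq_mul]
  rw [← Finset.mul_prod_erase _ _ (Finset.mem_univ i),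
    ← Finset.mul_prod_erase _ (fun j => siteKernel t (y j) (x j)) (Finset.mem_univ i)]
  rw [Function.update_self, siteKernel_mask hm]
  have hprod : ∏ j ∈ Finset.univ.erase i, siteKernel t (y j) (Function.update x i m j) =
      ∏ j ∈ Finset.univ.erase i, siteKernel t (y j) (x j) :=
    Finset.prod_congr rfl fun j hj => by rw [Function.update_of_ne (Finset.ne_of_mem_erase hj)]
  rw [hprod]
  ring

open scoped Matrix.Norms.Operator in
/-- The semigroup of the forward generator is the product kernel. -/
theorem exp_smul_fwdRate {m : Fin K} (hm : IsMask m) (t : ℝ) :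
    NormedSpace.exp (t • fwdRate K d) = seqKernel K d t := by
  have hE : ∀ s : ℝ, HasDerivAt (fun s : ℝ => NormedSpace.exp (s • (-fwdRate K d)))
      (-fwdRate K d * NormedSpace.exp (s • (-fwdRate K d))) s :=
    fun s => hasDerivAt_exp_smul_const' (-fwdRate K d) s
  have hG : ∀ s : ℝ, HasDerivAt (fun s => seqKernel K d s) (seqKernel K d s * fwdRate K d) s :=
    fun s => hasDerivAt_pi.2 fun y => hasDerivAt_pi.2 fun x => hasDerivAt_seqKernel_apply hm s y x
  have hP : ∀ s : ℝ, HasDerivAt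
      (fun s : ℝ => seqKernel K d s * NormedSpace.exp (s • (-fwdRate K d))) 0 s := fun s => by
    refine ((hG s).mul (hE s)).congr_deriv ?_
    rw [mul_assoc, neg_mul, mul_neg, add_neg_cancel]
  have hc := is_const_of_deriv_eq_zero (fun s => (hP s).differentiableAt) (fun s => (hP s).deriv)
    t 0
  rw [seqKernel_zero, zero_smul, NormedSpace.exp_zero, mul_one, smul_neg] at hc
  have hinv : NormedSpace.exp (-(t • fwdRate K d)) * NormedSpace.exp (t • fwdRate K d) = 1 := by
    rw [← Matrix.exp_add_of_commute _ _ (Commute.neg_left (Commute.refl (t • fwdRate K d))),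
      neg_add_cancel, NormedSpace.exp_zero]
  calc NormedSpace.exp (t • fwdRate K d)
      = seqKernel K d t * NormedSpace.exp (-(t • fwdRate K d)) *
          NormedSpace.exp (t • fwdRate K d) := by rw [hc, one_mul]
    _ = seqKernel K d t := by rw [mul_assoc, hinv, mul_one]

/-! ### Total variation distance -/

section TotalVariation

variable {α : Type*} [Fintype α]

theorem tvDist_triangle (p q r : α → ℝ) : tvDist p r ≤ tvDist p q + tvDist q r := by
  unfold tvDist
  rw [← mul_add, ← Finset.sum_add_distrib]
  gcongr with a
  exact abs_sub_le _ _ _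

theorem tvDist_comm (p q : α → ℝ) : tvDist p q = tvDist q p := by
  unfold tvDist
  simp_rw [abs_sub_comm]

theorem tvDist_pointMass [DecidableEq α] {p : α → ℝ} (hp : IsProb p) (z : α) :
    tvDist p (fun a => if a = z then 1 else 0) = 1 - p z := by
  have h1 : p z ≤ 1 := hp.2 ▸ Finset.single_le_sum (fun a _ => hp.1 a) (Finset.mem_univ z)
  have h2 := Finset.add_sum_erase _ p (Finset.mem_univ z)
  unfold tvDist
  rw [← Finset.add_sum_erase _ _ (Finset.mem_univ z)]
  have h3 : ∑ a ∈ Finset.univ.erase z, |p a - if a = z then 1 else 0| =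
      ∑ a ∈ Finset.univ.erase z, p a := Finset.sum_congr rfl fun a ha => by
    rw [if_neg (Finset.ne_of_mem_erase ha), sub_zero, abs_of_nonneg (hp.1 a)]
  simp only [h3, if_true]
  rw [abs_of_nonpos (by linarith)]
  linarith [hp.2]

/-- A stochastic matrix does not increase the total variation distance. -/
theorem tvDist_mulVec_le {A : Matrix α α ℝ} (hA : ∀ y x, 0 ≤ A y x) (hA1 : ∀ x, ∑ y, A y x = 1)
    (p q : α → ℝ) : tvDist (A *ᵥ p) (A *ᵥ q) ≤ tvDist p q := by
  unfold tvDist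
  gcongr 1 / 2 * ?_
  calc ∑ y, |(A *ᵥ p) y - (A *ᵥ q) y|
      ≤ ∑ y, ∑ x, A y x * |p x - q x| := by
        refine Finset.sum_le_sum fun y _ => ?_
        rw [Matrix.mulVec, Matrix.mulVec, dotProduct, dotProduct, ← Finset.sum_sub_distrib]
        refine (Finset.abs_sum_le_sum_abs _ _).trans (le_of_eq ?_)
        refine Finset.sum_congr rfl fun x _ => ?_
        rw [← mul_sub, abs_mul, abs_of_nonneg (hA y x)]
    _ = ∑ x, |p x - q x| := by
        rw [Finset.sum_comm]
        simp_rw [← Finset.sum_mul, hA1, one_mul]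

/-- The mean value inequality for curves in `ℓ¹`. -/
theorem sum_abs_sub_le_of_hasDerivAt {g g' : ℝ → α → ℝ} {a b C : ℝ} (hab : a ≤ b)
    (hg : ∀ t ∈ Set.Icc a b, ∀ i, HasDerivAt (fun t => g t i) (g' t i) t)
    (hC : ∀ t ∈ Set.Icc a b, ∑ i, |g' t i| ≤ C) :
    ∑ i, |g b i - g a i| ≤ C * (b - a) := by
  -- test the curve against the signs of the coordinates of its total increment
  set σ : α → ℝ := fun i => (SignType.sign (g b i - g a i) : ℝ) with hσ
  have hσ1 : ∀ i, |σ i| ≤ 1 := fun i => by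
    simp only [hσ]
    rcases lt_trichotomy (g b i - g a i) 0 with h | h | h <;> simp [h]
  have h := norm_image_sub_le_of_norm_deriv_le_segment' (f := fun t => ∑ i, σ i * g t i)
    (f' := fun t => ∑ i, σ i * g' t i) (C := C) (a := a) (b := b)
    (fun t ht => (HasDerivAt.fun_sum fun i _ => (hg t ht i).const_mul (σ i)).hasDerivWithinAt)
    (fun t ht => by
      rw [Real.norm_eq_abs]
      refine (Finset.abs_sum_le_sum_abs _ _).trans
        (le_trans (Finset.sum_le_sum fun i _ => ?_) (hC t (Set.Ico_subset_Icc_self ht)))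
      rw [abs_mul]
      exact mul_le_of_le_one_left (abs_nonneg _) (hσ1 i)) b (Set.right_mem_Icc.2 hab)
  refine le_trans (le_of_eq ?_) ((le_abs_self _).trans h)
  rw [← Finset.sum_sub_distrib]
  refine Finset.sum_congr rfl fun i _ => ?_
  rw [← mul_sub]
  exact (sign_mul_self _).symm

end TotalVariation

/-! ### The forward law -/

theorem fwdLaw_apply {m : Fin K} (hm : IsMask m) (q : Sq K d → ℝ) (t : ℝ) (y : Sq K d) :
    fwdLaw q t y = ∑ x, seqKernel K d t y x * q x := by
  rw [fwdLaw, exp_smul_fwdRate hm]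
  rfl

theorem fwdLaw_zero (q : Sq K d → ℝ) : fwdLaw q 0 = q := by
  simp [fwdLaw]

theorem isProb_fwdLaw {m : Fin K} (hm : IsMask m) {q : Sq K d → ℝ} (hq : IsProb q) {t : ℝ}
    (ht : 0 ≤ t) : IsProb (fwdLaw q t) := by
  constructor
  · intro y
    rw [fwdLaw_apply hm]
    exact Finset.sum_nonneg fun x _ => mul_nonneg (seqKernel_nonneg ht y x) (hq.1 x)
  · simp_rw [fwdLaw_apply hm]
    rw [Finset.sum_comm]
    simp_rw [← Finset.sum_mul, sum_seqKernel hm, one_mul]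
    exact hq.2

theorem sum_abs_eq_one {α : Type*} [Fintype α] {p : α → ℝ} (hp : IsProb p) : ∑ a, |p a| = 1 := by
  rw [← hp.2]
  exact Finset.sum_congr rfl fun a _ => abs_of_nonneg (hp.1 a)

theorem fwdLaw_pos {m : Fin K} (hm : IsMask m) (hK : 2 ≤ K) {q : Sq K d → ℝ} (hq : IsProb q)
    (hsupp : ∀ y, 0 < q y ↔ numMask y = 0) {t : ℝ} (ht : 0 < t) (y : Sq K d) :
    0 < fwdLaw q t y := by
  -- the masked tokens of `y` are completed by an arbitrary unmasked token
  let b : Fin K := ⟨0, by omega⟩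
  let x : Sq K d := fun i => if IsMask (y i) then b else y i
  have hb : ¬ IsMask b := by simp only [IsMask, b]; omega
  have hx : 0 < q x := by
    rw [hsupp, numMask, Finset.card_eq_zero, Finset.filter_eq_empty_iff]
    intro i _
    by_cases h : IsMask (y i) <;> simp [x, h, hb]
  have he : Real.exp (-t) < 1 := Real.exp_lt_one_iff.2 (by linarith)
  have hker : 0 < seqKernel K d t y x := by
    simp only [seqKernel, Matrix.of_apply]
    refine Finset.prod_pos fun i _ => ?_
    have := Real.exp_pos (-t)
    by_cases h : IsMask (y i)
    · simp only [siteKernel, h, x, if_true]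
      split_ifs <;> linarith
    · simpa [siteKernel, h, x] using this
  rw [fwdLaw_apply hm]
  exact Finset.sum_pos' (fun z _ => mul_nonneg (seqKernel_nonneg ht.le y z) (hq.1 z))
    ⟨x, Finset.mem_univ x, mul_pos hker hx⟩

open scoped Matrix.Norms.Operator in
theorem hasDerivAt_fwdLaw (q : Sq K d → ℝ) (t : ℝ) (y : Sq K d) :
    HasDerivAt (fun t => fwdLaw q t y) ((fwdRate K d *ᵥ fwdLaw q t) y) t := by
  have h : HasDerivAt (fun t : ℝ => NormedSpace.exp (t • fwdRate K d))
      (fwdRate K d * NormedSpace.exp (t • fwdRate K d)) t :=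
    hasDerivAt_exp_smul_const' (fwdRate K d) t
  have h2 := hasDerivAt_pi.1 (hasDerivAt_pi.1 h y)
  have h3 := HasDerivAt.fun_sum (u := Finset.univ) fun x _ => (h2 x).mul_const (q x)
  refine h3.congr_deriv ?_
  rw [fwdLaw, Matrix.mulVec_mulVec]
  rfl

theorem sum_abs_fwdLaw_sub_le {m : Fin K} (hm : IsMask m) {q : Sq K d → ℝ} (hq : IsProb q)
    {t u : ℝ} (ht : 0 ≤ t) (htu : t ≤ u) :
    ∑ y, |fwdLaw q u y - fwdLaw q t y| ≤ 2 * d * (u - t) := by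
  refine sum_abs_sub_le_of_hasDerivAt htu (fun r _ y => hasDerivAt_fwdLaw q r y) fun r hr => ?_
  refine (sum_abs_fwdRate_mulVec_le hm _).trans ?_
  rw [sum_abs_eq_one (isProb_fwdLaw hm hq (ht.trans hr.1)), mul_one]

theorem tvDist_fwdLaw_self_le {m : Fin K} (hm : IsMask m) {q : Sq K d → ℝ} (hq : IsProb q)
    {t : ℝ} (ht : 0 ≤ t) : tvDist q (fwdLaw q t) ≤ d * t := by
  have h := sum_abs_fwdLaw_sub_le hm hq le_rfl ht
  rw [fwdLaw_zero, sub_zero] at h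
  rw [tvDist_comm, tvDist]
  linarith

/-- A backward step of length `h` agrees with its linearization up to second order. -/
theorem tvDist_fwdLaw_sub_linear_le {m : Fin K} (hm : IsMask m) {q : Sq K d → ℝ} (hq : IsProb q)
    {t h : ℝ} (hh : 0 ≤ h) (hht : h ≤ t) :
    tvDist (fwdLaw q (t - h)) (fun y => fwdLaw q t y - h * (fwdRate K d *ᵥ fwdLaw q t) y) ≤
      2 * d ^ 2 * h ^ 2 := by
  have key := sum_abs_sub_le_of_hasDerivAt
    (g := fun r y => fwdLaw q (t - r) y + r * (fwdRate K d *ᵥ fwdLaw q t) y)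
    (g' := fun r y => (fwdRate K d *ᵥ (fwdLaw q t - fwdLaw q (t - r))) y)
    (a := 0) (b := h) (C := 4 * d ^ 2 * h) hh ?_ ?_
  · unfold tvDist
    have e : ∀ y, |fwdLaw q (t - h) y - (fwdLaw q t y - h * (fwdRate K d *ᵥ fwdLaw q t) y)| =
        |fwdLaw q (t - h) y + h * (fwdRate K d *ᵥ fwdLaw q t) y -
          (fwdLaw q (t - 0) y + 0 * (fwdRate K d *ᵥ fwdLaw q t) y)| := fun y => by
      rw [sub_zero]
      congr 1
      ring
    simp_rw [e]
    linarith
  · intro r _ y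
    have h1 : HasDerivAt (fun r : ℝ => t - r) (-1) r := (hasDerivAt_id r).const_sub t
    have h2 := (HasDerivAt.comp r (hasDerivAt_fwdLaw q (t - r) y) h1).add
      ((hasDerivAt_id r).mul_const ((fwdRate K d *ᵥ fwdLaw q t) y))
    refine h2.congr_deriv ?_
    rw [Matrix.mulVec_sub, Pi.sub_apply]
    ring
  · intro r hr
    refine (sum_abs_fwdRate_mulVec_le hm _).trans ?_
    have h3 := sum_abs_fwdLaw_sub_le hm hq (t := t - r) (u := t) (by linarith [hr.2])
      (by linarith [hr.1])
    have hd : (0 : ℝ) ≤ d := Nat.cast_nonneg d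
    calc 2 * (d : ℝ) * ∑ y, |(fwdLaw q t - fwdLaw q (t - r)) y|
        ≤ 2 * d * (2 * d * h) := by
          refine mul_le_mul_of_nonneg_left (h3.trans ?_) (by positivity)
          have : t - (t - r) ≤ h := by linarith [hr.2]
          gcongr
      _ = 4 * d ^ 2 * h := by ring

/-- The masking probability `1 - exp (-t)` of a token hardly changes over a time `h ≪ δ ≤ t`. -/
theorem one_sub_exp_neg_ge {δ h t u : ℝ} (hδ : 0 < δ) (ht : δ ≤ t) (htu : t ≤ u)
    (hu : u ≤ t + h) :
    (1 - h / δ) * (1 - Real.exp (-u)) ≤ 1 - Real.exp (-t) := by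
  have h1 : Real.exp (-t) * (1 + δ) ≤ 1 := by
    have := Real.add_one_le_exp t
    calc Real.exp (-t) * (1 + δ) ≤ Real.exp (-t) * Real.exp t := by gcongr; linarith
      _ = 1 := by rw [← Real.exp_add]; simp
  have h2 : Real.exp (-t) * (1 - h) ≤ Real.exp (-u) := by
    have := Real.add_one_le_exp (t - u)
    calc Real.exp (-t) * (1 - h) ≤ Real.exp (-t) * Real.exp (t - u) := by gcongr; linarith
      _ = Real.exp (-u) := by rw [← Real.exp_add]; congr 1; ring
  have hh : 0 ≤ h := by linarith
  have h3 : 0 ≤ h / δ := by positivity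
  have h4 : h / δ * δ = h := by field_simp
  have h5 := Real.exp_pos (-t)
  have h7 : Real.exp (-u) ≤ Real.exp (-t) := Real.exp_le_exp.2 (by linarith)
  nlinarith

theorem half_mul_fwdLaw_le {m : Fin K} (hm : IsMask m) {q : Sq K d → ℝ} (hq : IsProb q)
    {δ h t u : ℝ} (hδ : 0 < δ) (ht : δ ≤ t) (htu : t ≤ u) (hu : u ≤ t + h)
    (hd : d * h ≤ δ / 2) (hhδ : h ≤ δ) (y : Sq K d) :
    1 / 2 * fwdLaw q u y ≤ fwdLaw q t y := by
  have hh : 0 ≤ h := by linarith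
  have hρ : 0 ≤ 1 - h / δ := by
    rw [sub_nonneg, div_le_one hδ]
    exact hhδ
  have hsite : ∀ a b : Fin K, (1 - h / δ) * siteKernel u a b ≤ siteKernel t a b := fun a b => by
    have h1 := one_sub_exp_neg_ge hδ ht htu hu
    have h2 : Real.exp (-u) ≤ Real.exp (-t) := Real.exp_le_exp.2 (by linarith)
    have h3 : 0 ≤ h / δ := by positivity
    have h4 := Real.exp_pos (-u)
    unfold siteKernel
    split_ifs <;> nlinarith
  have hpow : 1 / 2 ≤ (1 - h / δ) ^ d := by
    have h1 := one_add_mul_le_pow (a := -(h / δ)) (by linarith) d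
    have h2 : d * (h / δ) ≤ 1 / 2 := by
      rw [← mul_div_assoc, div_le_iff₀ hδ]
      linarith
    rw [← sub_eq_add_neg] at h1
    linarith
  have hker : ∀ x, 1 / 2 * seqKernel K d u y x ≤ seqKernel K d t y x := fun x => by
    have h0 := seqKernel_nonneg (K := K) (hδ.le.trans (ht.trans htu)) y x
    calc 1 / 2 * seqKernel K d u y x ≤ (1 - h / δ) ^ d * seqKernel K d u y x := by gcongr
      _ = ∏ i, (1 - h / δ) * siteKernel u (y i) (x i) := by
          simp [seqKernel, Finset.prod_mul_distrib]
      _ ≤ seqKernel K d t y x := by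
          simp only [seqKernel, Matrix.of_apply]
          exact Finset.prod_le_prod (fun i _ => mul_nonneg hρ
            (siteKernel_nonneg (hδ.le.trans (ht.trans htu)) _ _)) fun i _ => hsite _ _
  rw [fwdLaw_apply hm, fwdLaw_apply hm, Finset.mul_sum]
  refine Finset.sum_le_sum fun x _ => ?_
  rw [← mul_assoc]
  exact mul_le_mul_of_nonneg_right (hker x) (hq.1 x)

/-! ### The initial laws of the sampler -/

theorem numMask_eq_iff {m : Fin K} (hm : IsMask m) (y : Sq K d) :
    numMask y = d ↔ y = fun _ => m := by
  have h := Finset.card_filter_eq_iff (s := (Finset.univ : Finset (Fin d)))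
    (p := fun i => IsMask (y i))
  rw [Finset.card_univ, Fintype.card_fin] at h
  rw [numMask, h]
  simp [funext_iff, isMask_iff_eq hm]

theorem maskLaw_eq {m : Fin K} (hm : IsMask m) :
    maskLaw K d = fun y => if y = (fun _ => m) then 1 else 0 := by
  funext y
  simp [maskLaw, numMask_eq_iff hm]

theorem tvDist_fwdLaw_maskLaw_le {m : Fin K} (hm : IsMask m) {q : Sq K d → ℝ} (hq : IsProb q)
    {t : ℝ} (ht : 0 ≤ t) : tvDist (fwdLaw q t) (maskLaw K d) ≤ d * Real.exp (-t) := by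
  have he : Real.exp (-t) ≤ 1 := Real.exp_le_one_iff.2 (by linarith)
  have hpow : 1 - d * Real.exp (-t) ≤ (1 - Real.exp (-t)) ^ d := by
    have h1 := one_add_mul_le_pow (a := -Real.exp (-t)) (by linarith) d
    rw [← sub_eq_add_neg] at h1
    linarith
  have hker : ∀ x : Sq K d, (1 - Real.exp (-t)) ^ d ≤ seqKernel K d t (fun _ => m) x := fun x => by
    simp only [seqKernel, Matrix.of_apply]
    calc (1 - Real.exp (-t)) ^ d = ∏ _i : Fin d, (1 - Real.exp (-t)) := by simp
      _ ≤ _ := by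
        refine Finset.prod_le_prod (fun _ _ => by linarith) fun i _ => ?_
        have := Real.exp_pos (-t)
        simp only [siteKernel, hm, if_true, mul_one]
        split_ifs <;> linarith
  rw [maskLaw_eq hm, tvDist_pointMass (isProb_fwdLaw hm hq ht), fwdLaw_apply hm]
  have : (1 - Real.exp (-t)) ^ d ≤ ∑ x, seqKernel K d t (fun _ => m) x * q x := by
    calc (1 - Real.exp (-t)) ^ d = ∑ x, (1 - Real.exp (-t)) ^ d * q x := by
          rw [← Finset.mul_sum, hq.2, mul_one]
      _ ≤ _ := Finset.sum_le_sum fun x _ => mul_le_mul_of_nonneg_right (hker x) (hq.1 x)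
  linarith

theorem isProb_tiltedLaw (hK : 0 < K) (T : ℝ) : IsProb (tiltedLaw K d T) := by
  have : Nonempty (Sq K d) := ⟨fun _ => ⟨0, hK⟩⟩
  have hpos : 0 < ∑ z : Sq K d, Real.exp (-T * ((d : ℝ) - numMask z)) :=
    Finset.sum_pos (fun _ _ => Real.exp_pos _) Finset.univ_nonempty
  constructor
  · intro y
    exact div_nonneg (Real.exp_pos _).le hpos.le
  · simp only [tiltedLaw]
    rw [← Finset.sum_div, div_self hpos.ne']

theorem sum_exp_tilt {m : Fin K} (hm : IsMask m) (T : ℝ) :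
    ∑ z : Sq K d, Real.exp (-T * ((d : ℝ) - numMask z)) = (1 + (K - 1) * Real.exp (-T)) ^ d := by
  have h1 : ∀ z : Sq K d, Real.exp (-T * ((d : ℝ) - numMask z)) =
      ∏ i, if IsMask (z i) then 1 else Real.exp (-T) := fun z => by
    have h2 : (d : ℝ) - numMask z = ∑ i, if IsMask (z i) then (0 : ℝ) else 1 := by
      have h3 : (numMask z : ℝ) = ∑ i, if IsMask (z i) then (1 : ℝ) else 0 := by
        simp [numMask]
      have h4 : (d : ℝ) = ∑ _i : Fin d, (1 : ℝ) := by simp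
      rw [h3]
      nth_rewrite 1 [h4]
      rw [← Finset.sum_sub_distrib]
      exact Finset.sum_congr rfl fun i _ => by split_ifs <;> norm_num
    rw [h2, Finset.mul_sum, Real.exp_sum]
    exact Finset.prod_congr rfl fun i _ => by split_ifs <;> simp
  simp_rw [h1]
  rw [← Fintype.prod_sum (fun (_ : Fin d) (a : Fin K) => if IsMask a then 1 else Real.exp (-T))]
  have h5 : ∑ a : Fin K, (if IsMask a then 1 else Real.exp (-T)) = 1 + (K - 1) * Real.exp (-T) := by
    have h6 : ∀ a : Fin K, (if IsMask a then 1 else Real.exp (-T)) =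
        Real.exp (-T) + if a = m then 1 - Real.exp (-T) else 0 := fun a => by
      simp only [isMask_iff_eq hm]
      split_ifs <;> ring
    simp_rw [h6]
    simp [Finset.sum_add_distrib]
    ring
  simp [h5]

theorem tvDist_maskLaw_tiltedLaw_le {m : Fin K} (hm : IsMask m) (T : ℝ) :
    tvDist (maskLaw K d) (tiltedLaw K d T) ≤ d * (K * Real.exp (-T)) := by
  have hK : 0 < K := m.pos
  have hK1 : (1 : ℝ) ≤ K := by exact_mod_cast hK
  have he := Real.exp_pos (-T)
  rw [tvDist_comm, maskLaw_eq hm, tvDist_pointMass (isProb_tiltedLaw hK T)]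
  have h1 : tiltedLaw K d T (fun _ => m) = 1 / (1 + (K - 1) * Real.exp (-T)) ^ d := by
    rw [tiltedLaw, sum_exp_tilt hm, (numMask_eq_iff hm _).2 rfl]
    simp
  have h2 : (1 + (K - 1) * Real.exp (-T)) ^ d ≤ Real.exp (d * (K * Real.exp (-T))) := by
    rw [Real.exp_nat_mul]
    refine pow_le_pow_left₀ (by nlinarith) ?_ d
    have := Real.add_one_le_exp (K * Real.exp (-T))
    linarith
  have h3 : (0 : ℝ) < (1 + (K - 1) * Real.exp (-T)) ^ d := pow_pos (by nlinarith) d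
  have h4 : 1 - d * (K * Real.exp (-T)) ≤ 1 / (1 + (K - 1) * Real.exp (-T)) ^ d := by
    calc 1 - d * (K * Real.exp (-T)) ≤ Real.exp (-(d * (K * Real.exp (-T)))) := by
          linarith [Real.add_one_le_exp (-(d * (K * Real.exp (-T))))]
      _ = 1 / Real.exp (d * (K * Real.exp (-T))) := by rw [Real.exp_neg, one_div]
      _ ≤ _ := one_div_le_one_div_of_le h3 h2
  rw [h1]
  linarith

/-! ### The Bregman divergence controls the absolute difference -/

/-- The Fenchel–Young inequality for `c ↦ c ln c`. -/
theorem mul_sub_mul_exp_le_bregman {u w : ℝ} (hu : 0 ≤ u) (hw : 0 < w) (θ : ℝ) :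
    θ * u - w * (Real.exp θ - 1) ≤ bregman u w := by
  unfold bregman
  rcases hu.eq_or_lt with rfl | hu
  · nlinarith [Real.exp_pos θ]
  · have h1 := Real.log_le_sub_one_of_pos (show 0 < w * Real.exp θ / u by positivity)
    rw [Real.log_div (by positivity) hu.ne', Real.log_mul hw.ne' (Real.exp_pos θ).ne',
      Real.log_exp] at h1
    have h2 := mul_le_mul_of_nonneg_left h1 hu.le
    have h3 : u * (w * Real.exp θ / u - 1) = w * Real.exp θ - u := by field_simp
    rw [Real.log_div hu.ne' hw.ne']
    nlinarith

theorem bregman_nonneg {u w : ℝ} (hu : 0 ≤ u) (hw : 0 < w) : 0 ≤ bregman u w := by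
  simpa using mul_sub_mul_exp_le_bregman hu hw 0

/-- A Pinsker-type inequality, linearized with a free parameter `μ`. -/
theorem abs_sub_le_bregman {u w μ : ℝ} (hu : 0 ≤ u) (hw : 0 < w) (hμ : 0 < μ)
    (hμ' : μ ≤ 1 / 2) : |u - w| ≤ 2 * μ * u + bregman u w / μ := by
  -- use the dual variables `ln (1 ± μ)`
  have h1 := mul_sub_mul_exp_le_bregman hu hw (Real.log (1 + μ))
  have h2 := mul_sub_mul_exp_le_bregman hu hw (Real.log (1 - μ))
  rw [Real.exp_log (by linarith)] at h1 h2
  have h3 : μ - 2 * μ ^ 2 ≤ Real.log (1 + μ) := by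
    refine le_trans ?_ (Real.one_sub_inv_le_log_of_pos (by linarith))
    rw [← sub_nonneg]
    have : 1 - (1 + μ)⁻¹ - (μ - 2 * μ ^ 2) = (μ ^ 2 + 2 * μ ^ 3) / (1 + μ) := by
      field_simp
      ring
    rw [this]
    positivity
  have h4 : -μ - 2 * μ ^ 2 ≤ Real.log (1 - μ) := by
    refine le_trans ?_ (Real.one_sub_inv_le_log_of_pos (by linarith))
    rw [← sub_nonneg]
    have h5 : 0 < 1 - μ := by linarith
    have : 1 - (1 - μ)⁻¹ - (-μ - 2 * μ ^ 2) = μ ^ 2 * (1 - 2 * μ) / (1 - μ) := by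
      field_simp
      ring
    rw [this]
    exact div_nonneg (mul_nonneg (sq_nonneg _) (by linarith)) h5.le
  have h5 := mul_le_mul_of_nonneg_right h3 hu
  have h6 := mul_le_mul_of_nonneg_right h4 hu
  have h7 : |u - w| * μ ≤ 2 * μ ^ 2 * u + bregman u w := by
    rcases abs_cases (u - w) with ⟨h, _⟩ | ⟨h, _⟩ <;> rw [h] <;> nlinarith
  rw [← le_div_iff₀ hμ] at h7
  refine h7.trans (le_of_eq ?_)
  field_simp

/-! ### The Euler kernel -/

theorem sum_erase_add_self {α : Type*} [Fintype α] [DecidableEq α] (f : α → ℝ) (a : α) :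
    f a + ∑ x ∈ Finset.univ.erase a, f x = ∑ x, f x :=
  Finset.add_sum_erase _ f (Finset.mem_univ a)

theorem sum_estRate_col (s : ℝ → Sq K d → Sq K d → ℝ) (t : ℝ) (y : Sq K d) :
    ∑ y', estRate s t y' y = 0 := by
  rw [← sum_erase_add_self _ y]
  have h : ∑ y' ∈ Finset.univ.erase y, estRate s t y' y =
      ∑ z ∈ Finset.univ.erase y, fwdRate K d y z * s t y z :=
    Finset.sum_congr rfl fun z hz => by
      simp [estRate, Finset.ne_of_mem_erase hz]
  rw [h]
  simp [estRate]

theorem sum_eulerKernel_col (s : ℝ → Sq K d → Sq K d → ℝ) (h t : ℝ) (y : Sq K d) :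
    ∑ y', eulerKernel s h t y' y = 1 := by
  simp only [eulerKernel, Matrix.add_apply, Matrix.smul_apply, smul_eq_mul,
    Finset.sum_add_distrib, ← Finset.mul_sum, sum_estRate_col]
  simp [Matrix.one_apply]

theorem eulerKernel_nonneg {m : Fin K} (hm : IsMask m) {s : ℝ → Sq K d → Sq K d → ℝ} {h t B : ℝ}
    (hh : 0 ≤ h) (hs : ∀ y z, y ≠ z → fwdRate K d y z ≠ 0 → 0 < s t y z ∧ s t y z ≤ B)
    (hB : 0 ≤ B) (hhB : h * (d * K * B) ≤ 1) (y' y : Sq K d) : 0 ≤ eulerKernel s h t y' y := by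
  simp only [eulerKernel, estRate, Matrix.add_apply, Matrix.smul_apply, smul_eq_mul,
    Matrix.one_apply, Matrix.of_apply]
  by_cases hy : y' = y
  · simp only [hy, if_true]
    have h1 : ∑ z ∈ Finset.univ.erase y, fwdRate K d y z * s t y z ≤ d * K * B := by
      calc ∑ z ∈ Finset.univ.erase y, fwdRate K d y z * s t y z
          ≤ ∑ z ∈ Finset.univ.erase y, fwdRate K d y z * B := by
            refine Finset.sum_le_sum fun z hz => ?_
            have hne := (Finset.ne_of_mem_erase hz).symm
            by_cases h0 : fwdRate K d y z = 0
            · simp [h0]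
            · exact mul_le_mul_of_nonneg_left (hs y z hne h0).2 (fwdRate_nonneg_of_ne hne)
        _ = (∑ z ∈ Finset.univ.erase y, fwdRate K d y z) * B := by rw [Finset.sum_mul]
        _ ≤ d * K * B := mul_le_mul_of_nonneg_right (sum_erase_fwdRate_row_le hm y) hB
    have h2 := mul_le_mul_of_nonneg_left h1 hh
    linarith
  · simp only [hy, if_false, zero_add]
    refine mul_nonneg hh ?_
    by_cases h0 : fwdRate K d y y' = 0
    · simp [h0]
    · exact mul_nonneg (fwdRate_nonneg_of_ne (Ne.symm hy)) (hs y y' (Ne.symm hy) h0).1.le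

/-- The reverse generator with the true score generates the time reversal: on the reverse law it
acts as minus the forward generator. -/
theorem estRate_score_mulVec {m : Fin K} (hm : IsMask m) {q : Sq K d → ℝ} {T t : ℝ}
    (hpos : ∀ y, revLaw q T t y ≠ 0) (y : Sq K d) :
    (estRate (score q T) t *ᵥ revLaw q T t) y = -(fwdRate K d *ᵥ revLaw q T t) y := by
  set p := revLaw q T t with hp
  have hsc : ∀ a b, score q T t a b * p a = p b := fun a b => div_mul_cancel₀ _ (hpos a)
  simp only [Matrix.mulVec, dotProduct]
  rw [← sum_erase_add_self _ y, ← sum_erase_add_self (fun x => fwdRate K d y x * p x) y]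
  have h1 : ∑ x ∈ Finset.univ.erase y, estRate (score q T) t y x * p x =
      (∑ x ∈ Finset.univ.erase y, fwdRate K d x y) * p y := by
    rw [Finset.sum_mul]
    refine Finset.sum_congr rfl fun x hx => ?_
    have hne := (Finset.ne_of_mem_erase hx).symm
    simp only [estRate, Matrix.of_apply, hne, if_false]
    rw [mul_assoc, hsc]
  have h2 : estRate (score q T) t y y * p y =
      -∑ x ∈ Finset.univ.erase y, fwdRate K d y x * p x := by
    simp only [estRate, Matrix.of_apply, if_true]
    rw [neg_mul, Finset.sum_mul]
    simp_rw [mul_assoc, hsc]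
  have h3 := sum_fwdRate_col hm y
  rw [← sum_erase_add_self _ y] at h3
  rw [h1, h2, eq_neg_of_add_eq_zero_right h3]
  ring

/-- Two Euler steps from the same law differ by the averaged difference of their jump rates. -/
theorem tvDist_eulerKernel_le {s v : ℝ → Sq K d → Sq K d → ℝ} {h t : ℝ} (hh : 0 ≤ h)
    {p : Sq K d → ℝ} (hp : ∀ y, 0 ≤ p y) :
    tvDist (eulerKernel v h t *ᵥ p) (eulerKernel s h t *ᵥ p) ≤
      h * ∑ y, p y * ∑ z ∈ Finset.univ.erase y, fwdRate K d y z * |v t y z - s t y z| := by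
  have hcol : ∀ y, ∑ y', |eulerKernel v h t y' y - eulerKernel s h t y' y| ≤
      h * (2 * ∑ z ∈ Finset.univ.erase y, fwdRate K d y z * |v t y z - s t y z|) := fun y => by
    have h1 : ∀ y', |eulerKernel v h t y' y - eulerKernel s h t y' y| =
        h * |estRate v t y' y - estRate s t y' y| := fun y' => by
      simp only [eulerKernel, Matrix.add_apply, Matrix.smul_apply, smul_eq_mul]
      rw [add_sub_add_left_eq_sub, ← mul_sub, abs_mul, abs_of_nonneg hh]
    simp_rw [h1]
    rw [← Finset.mul_sum]
    refine mul_le_mul_of_nonneg_left ?_ hh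
    have h2 : ∑ z ∈ Finset.univ.erase y, |estRate v t z y - estRate s t z y| =
        ∑ z ∈ Finset.univ.erase y, fwdRate K d y z * |v t y z - s t y z| :=
      Finset.sum_congr rfl fun z hz => by
        have hne := Finset.ne_of_mem_erase hz
        simp only [estRate, Matrix.of_apply, hne, if_false]
        rw [← mul_sub, abs_mul, abs_of_nonneg (fwdRate_nonneg_of_ne hne.symm)]
    have h3 : |estRate v t y y - estRate s t y y| ≤
        ∑ z ∈ Finset.univ.erase y, fwdRate K d y z * |v t y z - s t y z| := by
      simp only [estRate, Matrix.of_apply, if_true]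
      rw [neg_sub_neg, abs_sub_comm, ← Finset.sum_sub_distrib]
      refine (Finset.abs_sum_le_sum_abs _ _).trans (le_of_eq ?_)
      refine Finset.sum_congr rfl fun z hz => ?_
      rw [← mul_sub, abs_mul,
        abs_of_nonneg (fwdRate_nonneg_of_ne (Finset.ne_of_mem_erase hz).symm)]
    rw [← sum_erase_add_self _ y, h2, two_mul]
    linarith
  unfold tvDist
  calc 1 / 2 * ∑ y', |(eulerKernel v h t *ᵥ p) y' - (eulerKernel s h t *ᵥ p) y'|
      ≤ 1 / 2 * ∑ y', ∑ y, |eulerKernel v h t y' y - eulerKernel s h t y' y| * p y := by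
        gcongr 1 / 2 * ?_
        refine Finset.sum_le_sum fun y' _ => ?_
        rw [Matrix.mulVec, Matrix.mulVec, dotProduct, dotProduct, ← Finset.sum_sub_distrib]
        refine (Finset.abs_sum_le_sum_abs _ _).trans (le_of_eq ?_)
        refine Finset.sum_congr rfl fun y _ => ?_
        rw [← sub_mul, abs_mul, abs_of_nonneg (hp y)]
    _ = 1 / 2 * ∑ y, (∑ y', |eulerKernel v h t y' y - eulerKernel s h t y' y|) * p y := by
        rw [Finset.sum_comm]
        simp_rw [Finset.sum_mul]
    _ ≤ 1 / 2 * ∑ y, h * (2 * ∑ z ∈ Finset.univ.erase y,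
          fwdRate K d y z * |v t y z - s t y z|) * p y := by
        gcongr 1 / 2 * ?_
        exact Finset.sum_le_sum fun y _ => mul_le_mul_of_nonneg_right (hcol y) (hp y)
    _ = _ := by
        rw [Finset.mul_sum, Finset.mul_sum]
        refine Finset.sum_congr rfl fun y _ => ?_
        ring

/-- The expected total jump rate of the time reversal is at most `d`. -/
theorem sum_revLaw_mul_score_le {m : Fin K} (hm : IsMask m) {q : Sq K d → ℝ} {T t : ℝ}
    (hp : IsProb (revLaw q T t)) (hpos : ∀ y, revLaw q T t y ≠ 0) :
    ∑ y, revLaw q T t y * ∑ z ∈ Finset.univ.erase y, fwdRate K d y z * score q T t y z ≤ d := by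
  set p := revLaw q T t
  have hsc : ∀ a b, p a * score q T t a b = p b := fun a b => mul_div_cancel₀ _ (hpos a)
  calc ∑ y, p y * ∑ z ∈ Finset.univ.erase y, fwdRate K d y z * score q T t y z
      = ∑ y, ∑ z ∈ Finset.univ.erase y, fwdRate K d y z * p z := by
        refine Finset.sum_congr rfl fun y _ => ?_
        rw [Finset.mul_sum]
        refine Finset.sum_congr rfl fun z _ => ?_
        rw [mul_left_comm, hsc]
    _ = ∑ z, ∑ y ∈ Finset.univ.erase z, fwdRate K d y z * p z :=
        Finset.sum_comm' fun y z => by simp [eq_comm]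
    _ = ∑ z, (∑ y ∈ Finset.univ.erase z, fwdRate K d y z) * p z := by simp_rw [Finset.sum_mul]
    _ ≤ ∑ z, d * p z := Finset.sum_le_sum fun z _ =>
        mul_le_mul_of_nonneg_right (sum_erase_fwdRate_col_le hm z) (hp.1 z)
    _ = d := by rw [← Finset.mul_sum, hp.2, mul_one]

/-! ### The error of the sampler -/

/-- Error of one Euler step that starts from the exact reverse law. -/
theorem tvDist_euler_step_le {m : Fin K} (hm : IsMask m) {q : Sq K d → ℝ} (hq : IsProb q)
    {s : ℝ → Sq K d → Sq K d → ℝ} {T t h μ : ℝ} (hh : 0 ≤ h) (hht : h ≤ T - t)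
    (hpos : ∀ y, 0 < revLaw q T t y) (hs : ∀ y z, y ≠ z → fwdRate K d y z ≠ 0 → 0 < s t y z)
    (hμ : 0 < μ) (hμ' : μ ≤ 1 / 2) :
    tvDist (revLaw q T (t + h)) (eulerKernel s h t *ᵥ revLaw q T t) ≤
      2 * d ^ 2 * h ^ 2 + (2 * μ * d * h + h / μ * ∑ y, revLaw q T t y *
        ∑ z ∈ Finset.univ.erase y, fwdRate K d y z * bregman (score q T t y z) (s t y z)) := by
  have hp : IsProb (revLaw q T t) := isProb_fwdLaw hm hq (hh.trans hht)
  refine (tvDist_triangle _ (eulerKernel (score q T) h t *ᵥ revLaw q T t) _).trans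
    (add_le_add ?_ ?_)
  · have h1 : eulerKernel (score q T) h t *ᵥ revLaw q T t =
        fun y => revLaw q T t y - h * (fwdRate K d *ᵥ revLaw q T t) y := by
      funext y
      rw [eulerKernel, Matrix.add_mulVec, Matrix.one_mulVec, Matrix.smul_mulVec, Pi.add_apply,
        Pi.smul_apply, estRate_score_mulVec hm fun y => (hpos y).ne', smul_eq_mul]
      ring
    have h2 := tvDist_fwdLaw_sub_linear_le hm hq hh hht
    rw [sub_sub] at h2
    rw [h1]
    exact h2
  · refine (tvDist_eulerKernel_le hh hp.1).trans ?_
    have h1 : ∑ y, revLaw q T t y * ∑ z ∈ Finset.univ.erase y,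
          fwdRate K d y z * |score q T t y z - s t y z| ≤
        2 * μ * (∑ y, revLaw q T t y * ∑ z ∈ Finset.univ.erase y,
          fwdRate K d y z * score q T t y z) +
        1 / μ * ∑ y, revLaw q T t y * ∑ z ∈ Finset.univ.erase y,
          fwdRate K d y z * bregman (score q T t y z) (s t y z) := by
      rw [Finset.mul_sum, Finset.mul_sum, ← Finset.sum_add_distrib]
      refine Finset.sum_le_sum fun y _ => ?_
      rw [mul_left_comm, mul_left_comm (1 / μ), ← mul_add]
      refine mul_le_mul_of_nonneg_left ?_ (hp.1 y)
      rw [Finset.mul_sum, Finset.mul_sum, ← Finset.sum_add_distrib]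
      refine Finset.sum_le_sum fun z hz => ?_
      rw [mul_left_comm, mul_left_comm (1 / μ), ← mul_add]
      have hne := (Finset.ne_of_mem_erase hz).symm
      by_cases h0 : fwdRate K d y z = 0
      · simp [h0]
      · refine mul_le_mul_of_nonneg_left ?_ (fwdRate_nonneg_of_ne hne)
        have := abs_sub_le_bregman (u := score q T t y z)
          (div_nonneg (hp.1 z) (hp.1 y)) (hs y z hne h0) hμ hμ'
        rwa [one_div_mul_eq_div]
    have h2 := sum_revLaw_mul_score_le hm hp fun y => (hpos y).ne'
    have h3 := mul_le_mul_of_nonneg_left h2 (show 0 ≤ 2 * μ by positivity)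
    calc _ ≤ h * (2 * μ * d + 1 / μ * ∑ y, revLaw q T t y * ∑ z ∈ Finset.univ.erase y,
          fwdRate K d y z * bregman (score q T t y z) (s t y z)) :=
          mul_le_mul_of_nonneg_left (h1.trans (by linarith)) hh
      _ = _ := by ring

/-- The average over a time step of the expectation of a nonnegative function dominates half of the
expectation at the beginning of the step. -/
theorem mul_sum_revLaw_le_integral {m : Fin K} (hm : IsMask m) {q : Sq K d → ℝ} (hq : IsProb q)
    {T δ t h : ℝ} (hδ : 0 < δ) (hh : 0 ≤ h) (ht : t + h ≤ T - δ) (hd : d * h ≤ δ / 2)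
    (hhδ : h ≤ δ) {B : Sq K d → ℝ} (hB : ∀ y, 0 ≤ B y) :
    h * ∑ y, revLaw q T t y * B y ≤ 2 * ∫ r in t..(t + h), ∑ y, revLaw q T r y * B y := by
  have hcont : Continuous fun r => ∑ y, revLaw q T r y * B y := by
    refine continuous_finsetSum _ fun y _ => Continuous.mul ?_ continuous_const
    have : Continuous fun r => fwdLaw q r y :=
      continuous_iff_continuousAt.2 fun r => (hasDerivAt_fwdLaw q r y).continuousAt
    exact this.comp (continuous_const.sub continuous_id)
  have h1 : ∫ _r in t..(t + h), (1 / 2 * ∑ y, revLaw q T t y * B y) ≤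
      ∫ r in t..(t + h), ∑ y, revLaw q T r y * B y := by
    refine intervalIntegral.integral_mono_on (by linarith) (by simp)
      (hcont.intervalIntegrable _ _) fun r hr => ?_
    rw [Finset.mul_sum]
    refine Finset.sum_le_sum fun y _ => ?_
    rw [← mul_assoc]
    refine mul_le_mul_of_nonneg_right ?_ (hB y)
    exact half_mul_fwdLaw_le hm hq hδ (by linarith [hr.2]) (by linarith [hr.1])
      (by linarith [hr.2]) hd hhδ y
  rw [intervalIntegral.integral_const, smul_eq_mul] at h1
  linarith

/-- The error of the sampler is at most the sum of the errors of the initial law, of the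
discretization and of the estimated score. -/
theorem tvDist_eulerLaw_le {m : Fin K} (hm : IsMask m) (hK : 2 ≤ K) {q : Sq K d → ℝ}
    (hq : IsProb q) (hsupp : ∀ y, 0 < q y ↔ numMask y = 0) {s : ℝ → Sq K d → Sq K d → ℝ}
    {T δ h μ : ℝ} {n : ℕ} (hδ : 0 < δ) (hh : 0 < h) (hn : 1 ≤ n) (hT : T - δ = n * h)
    (hd : d * h ≤ δ / 2) (hhδ : h ≤ δ)
    (hs : ∀ k < n, ∀ y z, y ≠ z → fwdRate K d y z ≠ 0 → 0 < s ((k : ℝ) * h) y z)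
    (hker : ∀ k < n, ∀ y' y, 0 ≤ eulerKernel s h ((k : ℝ) * h) y' y)
    (hμ : 0 < μ) (hμ' : μ ≤ 1 / 2) (p : Sq K d → ℝ) :
    tvDist (fwdLaw q δ) (eulerLaw s h p n) ≤ tvDist (fwdLaw q T) p +
      (T - δ) * (2 * d ^ 2 * h + 2 * μ * d + 2 / μ * disScoreLoss q s T δ h n) := by
  set B : ℕ → Sq K d → ℝ := fun k y => ∑ z ∈ Finset.univ.erase y,
    fwdRate K d y z * bregman (score q T ((k : ℝ) * h) y z) (s ((k : ℝ) * h) y z) with hBdef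
  have hle : ∀ k < n, ((k : ℝ) + 1) * h ≤ T - δ := fun k hk => by
    rw [hT]
    have : (k : ℝ) + 1 ≤ n := by exact_mod_cast hk
    gcongr
  have hstep : ∀ k < n, tvDist (revLaw q T (((k : ℝ) + 1) * h))
      (eulerKernel s h ((k : ℝ) * h) *ᵥ revLaw q T ((k : ℝ) * h)) ≤
      2 * d ^ 2 * h ^ 2 + 2 * μ * d * h + 2 / μ *
        ∫ t in ((k : ℝ) * h)..(((k : ℝ) + 1) * h), ∑ y, revLaw q T t y * B k y := fun k hk => by
    have hk1 := hle k hk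
    have hpos : ∀ y, 0 < revLaw q T ((k : ℝ) * h) y := fun y =>
      fwdLaw_pos hm hK hq hsupp (by linarith) y
    have hB : ∀ y, 0 ≤ B k y := fun y => Finset.sum_nonneg fun z hz => by
      have hne := (Finset.ne_of_mem_erase hz).symm
      by_cases h0 : fwdRate K d y z = 0
      · simp [h0]
      · exact mul_nonneg (fwdRate_nonneg_of_ne hne)
          (bregman_nonneg (div_nonneg (hpos z).le (hpos y).le) (hs k hk y z hne h0))
    have e : ((k : ℝ) + 1) * h = (k : ℝ) * h + h := by ring
    rw [e] at hk1 ⊢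
    have h1 := tvDist_euler_step_le hm hq hh.le (by linarith) hpos (hs k hk) hμ hμ'
    have h2 := mul_sum_revLaw_le_integral hm hq hδ hh.le hk1 hd hhδ hB
    have h3 := mul_le_mul_of_nonneg_left h2 (show 0 ≤ 1 / μ by positivity)
    refine h1.trans ?_
    have e1 : h / μ * ∑ y, revLaw q T ((k : ℝ) * h) y * B k y =
        1 / μ * (h * ∑ y, revLaw q T ((k : ℝ) * h) y * B k y) := by ring
    have e2 : ∀ I : ℝ, 2 / μ * I = 1 / μ * (2 * I) := fun I => by ring
    rw [e2]
    change 2 * (d : ℝ) ^ 2 * h ^ 2 + (2 * μ * d * h +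
      h / μ * ∑ y, revLaw q T ((k : ℝ) * h) y * B k y) ≤ _
    rw [e1]
    linarith
  have hind : ∀ k ≤ n, tvDist (revLaw q T ((k : ℝ) * h)) (eulerLaw s h p k) ≤
      tvDist (fwdLaw q T) p + ∑ j ∈ Finset.range k, (2 * d ^ 2 * h ^ 2 + 2 * μ * d * h + 2 / μ *
        ∫ t in ((j : ℝ) * h)..(((j : ℝ) + 1) * h), ∑ y, revLaw q T t y * B j y) := by
    intro k
    induction k with
    | zero => intro _; simp [revLaw, eulerLaw]
    | succ k ih =>
      intro hk
      rw [Finset.sum_range_succ, Nat.cast_succ, eulerLaw]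
      have h1 := tvDist_triangle (revLaw q T (((k : ℝ) + 1) * h))
        (eulerKernel s h ((k : ℝ) * h) *ᵥ revLaw q T ((k : ℝ) * h))
        (eulerKernel s h ((k : ℝ) * h) *ᵥ eulerLaw s h p k)
      have h2 := tvDist_mulVec_le (hker k hk) (sum_eulerKernel_col s h ((k : ℝ) * h))
        (revLaw q T ((k : ℝ) * h)) (eulerLaw s h p k)
      linarith [ih (Nat.le_of_succ_le hk), hstep k hk]
  have hfin := hind n le_rfl
  have hTδ : 0 < T - δ := by
    rw [hT]
    have : (0 : ℝ) < n := by exact_mod_cast hn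
    positivity
  have hloss : ∑ j ∈ Finset.range n, (∫ t in ((j : ℝ) * h)..(((j : ℝ) + 1) * h),
      ∑ y, revLaw q T t y * B j y) = (T - δ) * disScoreLoss q s T δ h n := by
    rw [disScoreLoss, ← mul_assoc, mul_one_div_cancel hTδ.ne', one_mul]
  rw [Finset.sum_add_distrib, ← Finset.mul_sum, hloss, Finset.sum_const, Finset.card_range,
    nsmul_eq_mul, ← hT, revLaw, sub_sub_cancel] at hfin
  refine hfin.trans (le_of_eq ?_)
  rw [hT]
  ring

/-! ### The horizon and the step size -/

theorem half_le_log_div {ε : ℝ} (hd : 1 ≤ d) (hε : 0 < ε) (hε' : ε ≤ 1 / 2) :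
    1 / 2 ≤ Real.log (d / ε) := by
  have hd1 : (1 : ℝ) ≤ d := by exact_mod_cast hd
  have h : (2 : ℝ) ≤ d / ε := by
    rw [le_div_iff₀ hε]
    linarith
  have := Real.log_le_log two_pos h
  linarith [Real.log_two_gt_d9]

theorem horizon_le {ε : ℝ} (hd : 1 ≤ d) (hε : 0 < ε) (hε' : ε ≤ 1 / 2) :
    horizon d ε ≤ 4 * Real.log (d / ε) := by
  have hd1 : (1 : ℝ) ≤ d := by exact_mod_cast hd
  have h : 4 * (d : ℝ) / ε ^ 2 ≤ (d / ε) ^ 4 := by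
    rw [div_pow, div_le_div_iff₀ (by positivity) (by positivity)]
    have h1 : (d : ℝ) ≤ d ^ 4 := le_self_pow₀ hd1 (by norm_num)
    have h2 : 4 * ε ^ 2 ≤ 1 := by nlinarith
    calc 4 * (d : ℝ) * ε ^ 4 = d * ε ^ 2 * (4 * ε ^ 2) := by ring
      _ ≤ d * ε ^ 2 * 1 := by gcongr
      _ ≤ d ^ 4 * ε ^ 2 := by rw [mul_one]; gcongr
  have := Real.log_le_log (by positivity) h
  rwa [Real.log_pow] at this

theorem exp_horizon {ε : ℝ} (hd : 1 ≤ d) (hε : 0 < ε) :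
    Real.exp (horizon d ε) = 4 * d / ε ^ 2 := by
  have hd1 : (1 : ℝ) ≤ d := by exact_mod_cast hd
  exact Real.exp_log (by positivity)

theorem one_le_horizon {ε : ℝ} (hd : 1 ≤ d) (hε : 0 < ε) (hε' : ε ≤ 1 / 2) :
    1 ≤ horizon d ε := by
  have hd1 : (1 : ℝ) ≤ d := by exact_mod_cast hd
  rw [← Real.exp_le_exp, exp_horizon hd hε, le_div_iff₀ (by positivity)]
  nlinarith [Real.exp_one_lt_d9]

theorem horizon_sq_le {ε : ℝ} (hd : 1 ≤ d) (hε : 0 < ε) (hε' : ε ≤ 1 / 2) :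
    horizon d ε ^ 2 ≤ 32 * (d / ε) := by
  have hd1 : (1 : ℝ) ≤ d := by exact_mod_cast hd
  have hT := one_le_horizon hd hε hε'
  -- `T / 4 ≤ exp (T / 4)`, raised to the fourth power
  have h1 : (horizon d ε / 4) ^ 4 ≤ 4 * d / ε ^ 2 := by
    rw [← exp_horizon hd hε]
    calc (horizon d ε / 4) ^ 4 ≤ Real.exp (horizon d ε / 4) ^ 4 := by
          gcongr
          linarith [Real.add_one_le_exp (horizon d ε / 4)]
      _ = Real.exp (horizon d ε) := by
          rw [← Real.exp_nat_mul]
          congr 1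
          push_cast
          ring
  have h2 : 4 * (d : ℝ) / ε ^ 2 ≤ (2 * (d / ε)) ^ 2 := by
    rw [mul_pow, div_pow, ← mul_div_assoc]
    gcongr
    · norm_num
    · exact le_self_pow₀ hd1 two_ne_zero
  have h3 : (horizon d ε ^ 2 / 16) ^ 2 ≤ (2 * (d / ε)) ^ 2 := by
    refine le_trans (le_of_eq ?_) (h1.trans h2)
    ring
  have h4 := le_of_sq_le_sq h3 (by positivity)
  linarith

theorem mul_exp_neg_horizon {ε : ℝ} (hd : 1 ≤ d) (hε : 0 < ε) :
    d * Real.exp (-horizon d ε) = ε ^ 2 / 4 := by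
  have hd1 : (1 : ℝ) ≤ d := by exact_mod_cast hd
  rw [Real.exp_neg, exp_horizon hd hε]
  field_simp

theorem earlyStop_le_half {ε : ℝ} (hd : 1 ≤ d) (hε : 0 < ε) (hε' : ε ≤ 1 / 2) :
    earlyStop d ε ≤ 1 / 2 := by
  have hd1 : (1 : ℝ) ≤ d := by exact_mod_cast hd
  exact (div_le_self hε.le hd1).trans hε'

theorem le_stepBound {ε : ℝ} (hK : 2 ≤ K) (hd : 1 ≤ d) (hε : 0 < ε) (hε' : ε ≤ 1 / 2) :
    ε ^ (3 / 2 : ℝ) / (2 * ((K : ℝ) ^ 2 * d ^ 2 * Real.log (d / ε))) ≤ stepBound K d ε := by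
  have hd1 : (1 : ℝ) ≤ d := by exact_mod_cast hd
  have hK1 : (2 : ℝ) ≤ K := by exact_mod_cast hK
  have hL := half_le_log_div hd hε hε'
  set L := Real.log (d / ε)
  refine le_min ?_ ?_
  · have h1 : ε ^ (3 / 2 : ℝ) ≤ ε := by
      calc ε ^ (3 / 2 : ℝ) ≤ ε ^ (1 : ℝ) :=
            Real.rpow_le_rpow_of_exponent_ge hε (by linarith) (by norm_num)
        _ = ε := Real.rpow_one ε
    have h2 : 0 < (K : ℝ) ^ 2 * d ^ 2 * L := by positivity
    exact div_le_div₀ hε.le h1 h2 (by linarith)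
  · have hs : 0 < Real.sqrt L := Real.sqrt_pos.2 (by linarith)
    have h1 : Real.sqrt L ≤ 2 * L := by
      rw [Real.sqrt_le_left (by linarith)]
      nlinarith
    have h2 : (d : ℝ) * Real.sqrt L ≤ 2 * ((K : ℝ) ^ 2 * d ^ 2 * L) := by
      have h3 : (d : ℝ) ≤ (K : ℝ) ^ 2 * d ^ 2 := by
        have h4 : (d : ℝ) ≤ d ^ 2 := le_self_pow₀ hd1 two_ne_zero
        nlinarith [mul_le_mul_of_nonneg_right (one_le_pow₀ (n := 2) (one_le_two.trans hK1))
          (sq_nonneg (d : ℝ))]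
      calc (d : ℝ) * Real.sqrt L ≤ ((K : ℝ) ^ 2 * d ^ 2) * (2 * L) := by gcongr
        _ = _ := by ring
    gcongr

theorem stepSize_pos {ε : ℝ} {n : ℕ} (hd : 1 ≤ d) (hε : 0 < ε) (hε' : ε ≤ 1 / 2) (hn : 1 ≤ n) :
    0 < stepSize d ε n := by
  have hn1 : (1 : ℝ) ≤ n := by exact_mod_cast hn
  have h1 := one_le_horizon hd hε hε'
  have h2 := earlyStop_le_half hd hε hε'
  exact div_pos (by linarith) (by linarith)

theorem exists_steps {c ε : ℝ} (hc : 0 < c) (hK : 2 ≤ K) (hd : 1 ≤ d) (hε : 0 < ε)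
    (hε' : ε ≤ 1 / 2) :
    ∃ n : ℕ, 1 ≤ n ∧ stepSize d ε n ≤ c * stepBound K d ε ∧
      (n : ℝ) ≤ (8 / c + 1) * (K : ℝ) ^ 2 * Real.log (d / ε) ^ 2 *
        ((d : ℝ) ^ 2 * ε ^ (-(3 / 2) : ℝ)) := by
  have hd1 : (1 : ℝ) ≤ d := by exact_mod_cast hd
  have hK1 : (2 : ℝ) ≤ K := by exact_mod_cast hK
  have hL := half_le_log_div hd hε hε'
  have hTL := horizon_le hd hε hε'
  have hT := one_le_horizon hd hε hε'
  have hB := le_stepBound hK hd hε hε'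
  have hδ : 0 < earlyStop d ε := div_pos hε (by linarith)
  set L := Real.log (d / ε)
  set T := horizon d ε
  have hεp : 0 < ε ^ (3 / 2 : ℝ) := Real.rpow_pos_of_pos hε _
  have hB0 : 0 < ε ^ (3 / 2 : ℝ) / (2 * ((K : ℝ) ^ 2 * d ^ 2 * L)) := by positivity
  have hBpos := hB0.trans_le hB
  set X : ℝ := (K : ℝ) ^ 2 * L ^ 2 * ((d : ℝ) ^ 2 * ε ^ (-(3 / 2) : ℝ)) with hX
  have hX1 : 1 ≤ X := by
    have h1 : 1 ≤ ε ^ (-(3 / 2) : ℝ) :=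
      Real.one_le_rpow_of_pos_of_le_one_of_nonpos hε (by linarith) (by norm_num)
    have h2 : 1 ≤ (K : ℝ) ^ 2 * L ^ 2 := by
      rw [← mul_pow]
      exact one_le_pow₀ (by nlinarith)
    exact one_le_mul_of_one_le_of_one_le h2
      (one_le_mul_of_one_le_of_one_le (one_le_pow₀ hd1) h1)
  have hy : 0 < T / (c * stepBound K d ε) := by positivity
  refine ⟨⌈T / (c * stepBound K d ε)⌉₊, Nat.one_le_iff_ne_zero.2 (Nat.ceil_pos.2 hy).ne', ?_, ?_⟩
  · have hn0 : (0 : ℝ) < ⌈T / (c * stepBound K d ε)⌉₊ := by exact_mod_cast Nat.ceil_pos.2 hy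
    rw [stepSize, div_le_iff₀ hn0]
    have h1 := Nat.le_ceil (T / (c * stepBound K d ε))
    rw [div_le_iff₀ (by positivity)] at h1
    linarith
  · have h1 := (Nat.ceil_lt_add_one hy.le).le
    have h2 : T / (c * stepBound K d ε) ≤ 8 / c * X := by
      calc T / (c * stepBound K d ε)
          ≤ 4 * L / (c * (ε ^ (3 / 2 : ℝ) / (2 * ((K : ℝ) ^ 2 * d ^ 2 * L)))) := by gcongr
        _ = 8 / c * X := by
          rw [hX, Real.rpow_neg hε.le]
          field_simp
          ring
    calc (⌈T / (c * stepBound K d ε)⌉₊ : ℝ) ≤ 8 / c * X + X := by linarith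
      _ = _ := by rw [hX]; ring

/-- The sampler error for an arbitrary initial law. The part `ε` is the cost of early stopping. -/
theorem tvDist_eulerLaw_le_of_stepBound {m : Fin K} (hm : IsMask m) (hK : 2 ≤ K) (hd : 1 ≤ d)
    {ε c εs : ℝ} (hε : 0 < ε) (hε' : ε ≤ 1 / 2) (hc : 0 < c) (hc' : c ≤ 1 / 128) {n : ℕ}
    (hn : 1 ≤ n) {q : Sq K d → ℝ} {s : ℝ → Sq K d → Sq K d → ℝ}
    (hh : stepSize d ε n * ((d : ℝ) ^ 2 * ((K : ℝ) ^ 2 * Real.log (d / ε))) ≤ c * ε)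
    (hq : IsProb q) (hsupp : ∀ y, 0 < q y ↔ numMask y = 0)
    (hs : ∀ k < n, ∀ y z, y ≠ z → fwdRate K d y z ≠ 0 →
      0 < s ((k : ℝ) * stepSize d ε n) y z)
    (hker : ∀ k < n, ∀ y' y,
      0 ≤ eulerKernel s (stepSize d ε n) ((k : ℝ) * stepSize d ε n) y' y)
    (hεs : 0 ≤ εs) (hεs' : εs ≤ c * (ε ^ 2 / d))
    (hloss : disScoreLoss q s (horizon d ε) (earlyStop d ε) (stepSize d ε n) n ≤ εs ^ 2)
    (p : Sq K d → ℝ) :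
    tvDist q (eulerLaw s (stepSize d ε n) p n) ≤
      ε + tvDist (fwdLaw q (horizon d ε)) p + ε / 4 := by
  have hd1 : (1 : ℝ) ≤ d := by exact_mod_cast hd
  have hK1 : (2 : ℝ) ≤ K := by exact_mod_cast hK
  have hn1 : (1 : ℝ) ≤ n := by exact_mod_cast hn
  have hL := half_le_log_div hd hε hε'
  have hTL := horizon_le hd hε hε'
  have hT := one_le_horizon hd hε hε'
  have hT2 := horizon_sq_le hd hε hε'
  have hh0 := stepSize_pos hd hε hε' hn
  have hδ : 0 < earlyStop d ε := div_pos hε (by linarith)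
  have hδ' := earlyStop_le_half hd hε hε'
  have hdδ : d * earlyStop d ε = ε := mul_div_cancel₀ _ (by positivity)
  have hnh : horizon d ε - earlyStop d ε = n * stepSize d ε n :=
    (mul_div_cancel₀ _ (by positivity)).symm
  have hself := tvDist_fwdLaw_self_le hm hq hδ.le
  rw [hdδ] at hself
  set L := Real.log (d / ε)
  set T := horizon d ε
  set δ := earlyStop d ε
  set h := stepSize d ε n
  have hhd : h * d ^ 2 * 2 ≤ c * ε := by
    refine le_trans ?_ hh
    rw [mul_assoc]
    gcongr
    nlinarith
  have hdh : d * h ≤ δ / 2 := by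
    have : d * (d * h) ≤ d * (δ / 2) := by nlinarith
    exact le_of_mul_le_mul_left this (by linarith)
  have hhδ : h ≤ δ := by nlinarith
  -- the parameter that balances the two terms of the score error
  set μ := ε / (64 * T * d) with hμdef
  have hμ : 0 < μ := by positivity
  have hμ' : μ ≤ 1 / 2 := by
    rw [hμdef, div_le_iff₀ (by positivity)]
    nlinarith
  have hmain := tvDist_eulerLaw_le hm hK hq hsupp hδ hh0 hn hnh hdh hhδ hs hker hμ hμ' p
  have hdisc : T * (2 * d ^ 2 * h) ≤ ε / 64 := by
    calc T * (2 * d ^ 2 * h) ≤ (4 * L) * (2 * d ^ 2 * h) := by gcongr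
      _ = 2 * (h * (d ^ 2 * (2 ^ 2 * L))) := by ring
      _ ≤ 2 * (h * (d ^ 2 * ((K : ℝ) ^ 2 * L))) := by gcongr
      _ ≤ 2 * (c * ε) := by gcongr
      _ ≤ 2 * (1 / 128 * ε) := by gcongr
      _ = ε / 64 := by ring
  have hμd : T * (2 * μ * d) = ε / 32 := by
    rw [hμdef]
    field_simp
    norm_num
  have hscore : T * (2 / μ * εs ^ 2) ≤ ε / 8 := by
    calc T * (2 / μ * εs ^ 2) ≤ T * (2 / μ * (1 / 128 * (ε ^ 2 / d)) ^ 2) := by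
          gcongr
          exact hεs'.trans (by gcongr)
      _ = T ^ 2 * (ε ^ 3 / (128 * d)) := by
          rw [hμdef]
          field_simp
          norm_num
      _ ≤ 32 * (d / ε) * (ε ^ 3 / (128 * d)) := by gcongr
      _ = ε * (ε / 4) := by
          field_simp
          norm_num
      _ ≤ ε * (1 / 8) := mul_le_mul_of_nonneg_left (by linarith) hε.le
      _ = ε / 8 := by ring
  have hbound : (T - δ) * (2 * d ^ 2 * h + 2 * μ * d + 2 / μ * disScoreLoss q s T δ h n) ≤
      ε / 4 := by
    calc (T - δ) * (2 * d ^ 2 * h + 2 * μ * d + 2 / μ * disScoreLoss q s T δ h n)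
        ≤ (T - δ) * (2 * d ^ 2 * h + 2 * μ * d + 2 / μ * εs ^ 2) := by
          have : 0 ≤ T - δ := by linarith
          gcongr
      _ ≤ T * (2 * d ^ 2 * h + 2 * μ * d + 2 / μ * εs ^ 2) := by
          have : 0 ≤ 2 * d ^ 2 * h + 2 * μ * d + 2 / μ * εs ^ 2 := by positivity
          exact mul_le_mul_of_nonneg_right (by linarith) this
      _ ≤ ε / 4 := by linarith
  linarith [tvDist_triangle q (fwdLaw q δ) (eulerLaw s h p n)]

end MaskedDiffusion

open MaskedDiffusion in
theorem theorem1 :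
    ∀ M : ℝ, 0 < M → ∃ c C : ℝ, 0 < c ∧ 0 < C ∧
      ∀ (K d : ℕ) (ε : ℝ), 2 ≤ K → 1 ≤ d → 0 < ε → ε ≤ 1 / 2 →
        (∃ n : ℕ, 1 ≤ n ∧ stepSize d ε n ≤ c * stepBound K d ε ∧
          (n : ℝ) ≤ C * (K : ℝ) ^ 2 * Real.log (d / ε) ^ 2 *
            ((d : ℝ) ^ 2 * ε ^ (-(3 / 2) : ℝ))) ∧
        ∀ (n : ℕ) (q : Sq K d → ℝ) (s : ℝ → Sq K d → Sq K d → ℝ) (εs : ℝ),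
          1 ≤ n → stepSize d ε n ≤ c * stepBound K d ε →
          IsProb q → (∀ y, 0 < q y ↔ numMask y = 0) →
          (∀ k < n, ∀ y y', y ≠ y' → fwdRate K d y y' ≠ 0 →
            0 < s ((k : ℝ) * stepSize d ε n) y y' ∧
              s ((k : ℝ) * stepSize d ε n) y y' ≤ M * (d / ε)) →
          0 ≤ εs → εs ≤ c * (ε ^ 2 / d) →
          disScoreLoss q s (horizon d ε) (earlyStop d ε) (stepSize d ε n) n ≤ εs ^ 2 →
          (∀ k < n, ∀ y y',
            0 ≤ eulerKernel s (stepSize d ε n) ((k : ℝ) * stepSize d ε n) y' y) ∧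
          tvDist q (eulerLaw s (stepSize d ε n) (maskLaw K d) n) ≤ 2 * ε ∧
          ((K : ℝ) * ε ≤ 1 →
            tvDist q (eulerLaw s (stepSize d ε n) (tiltedLaw K d (horizon d ε)) n) ≤ 2 * ε) := by
  intro M hM
  have hc : 0 < min (1 / 128) (1 / M) := by positivity
  refine ⟨min (1 / 128) (1 / M), 8 / min (1 / 128) (1 / M) + 1, hc, by positivity, ?_⟩
  have hc1 : min (1 / 128) (1 / M) ≤ 1 / 128 := min_le_left _ _
  have hcM : min (1 / 128) (1 / M) * M ≤ 1 := by
    rw [← le_div_iff₀ hM]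
    exact min_le_right _ _
  generalize min (1 / 128) (1 / M) = c at hc hc1 hcM ⊢
  intro K d ε hK hd hε hε'
  refine ⟨exists_steps hc hK hd hε hε', ?_⟩
  intro n q s εs hn hstep hq hsupp hs hεs hεs' hloss
  have hd1 : (1 : ℝ) ≤ d := by exact_mod_cast hd
  have hK1 : (2 : ℝ) ≤ K := by exact_mod_cast hK
  have hL := half_le_log_div hd hε hε'
  have hT := one_le_horizon hd hε hε'
  have hh0 := stepSize_pos hd hε hε' hn
  have hmask : IsMask (⟨K - 1, by omega⟩ : Fin K) := by
    simp only [IsMask]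
    omega
  have hh : stepSize d ε n * ((d : ℝ) ^ 2 * ((K : ℝ) ^ 2 * Real.log (d / ε))) ≤ c * ε := by
    have h1 : stepSize d ε n ≤ c * (ε / ((K : ℝ) ^ 2 * (d : ℝ) ^ 2 * Real.log (d / ε))) :=
      hstep.trans (mul_le_mul_of_nonneg_left (min_le_left _ _) hc.le)
    rw [← mul_div_assoc, le_div_iff₀ (by positivity)] at h1
    linarith
  have hker : ∀ k < n, ∀ y' y,
      0 ≤ eulerKernel s (stepSize d ε n) ((k : ℝ) * stepSize d ε n) y' y := fun k hk => by
    refine eulerKernel_nonneg hmask hh0.le (hs k hk) (by positivity) ?_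
    have hKL : (K : ℝ) ≤ (K : ℝ) ^ 2 * Real.log (d / ε) := by
      nlinarith [mul_le_mul_of_nonneg_left hL (sq_nonneg (K : ℝ))]
    calc stepSize d ε n * (d * K * (M * (d / ε)))
        = stepSize d ε n * ((d : ℝ) ^ 2 * K) * (M / ε) := by ring
      _ ≤ stepSize d ε n * ((d : ℝ) ^ 2 * ((K : ℝ) ^ 2 * Real.log (d / ε))) * (M / ε) := by
          gcongr
      _ ≤ c * ε * (M / ε) := by gcongr
      _ = c * M := by field_simp
      _ ≤ 1 := hcM
  have herr := tvDist_eulerLaw_le_of_stepBound hmask hK hd hε hε' hc hc1 hn hh hq hsupp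
    (fun k hk y z hyz h0 => (hs k hk y z hyz h0).1) hker hεs hεs' hloss
  have hinit := tvDist_fwdLaw_maskLaw_le hmask hq (zero_le_one.trans hT)
  have hexp := mul_exp_neg_horizon hd hε
  rw [hexp] at hinit
  have hε2 : ε ^ 2 / 4 ≤ ε / 8 := by nlinarith
  refine ⟨fun k hk y y' => hker k hk y' y, by linarith [herr (maskLaw K d)], fun hKε => ?_⟩
  have htilt := tvDist_maskLaw_tiltedLaw_le (d := d) hmask (horizon d ε)
  rw [mul_left_comm, hexp] at htilt
  have hKε2 : K * (ε ^ 2 / 4) ≤ ε / 4 := by nlinarith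
  linarith [herr (tiltedLaw K d (horizon d ε)), tvDist_triangle (fwdLaw q (horizon d ε))
    (maskLaw K d) (tiltedLaw K d (horizon d ε))]
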